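/- **Setting.** A server holds $N$ files of $F\ge 1$ bits each and is connected by a shared error-free link to $K$ users, each with a cache of $MF$ bits, where $M\ge 0$ is real. Each user $k$ independently requests file $d_k\in\{1,\dots,N\}$, with $\Pr[d_k=n]=p_n$, where $p_n\ge 0$ and $\sum_n p_n=1$. A *caching scheme with uncoded placement* consists of: a placement, in which each user stores verbatim a set of at most $MF$ bits of the files; and, for every demand vector $\mathbf d=(d_1,\dots,d_K)$, a multicast message of $L(\mathbf d)$ bits, an arbitrary function of the files, from which every user $k$, using also its own cache contents, recovers file $d_k$ exactly. Its delivery rate for $\mathbf d$ is $R(\mathbf d)=L(\mathbf d)/F$ and its average delivery rate is $\bar R=\sum_{\mathbf d}\big(\prod_{k=1}^K p_{d_k}\big)R(\mathbf d)$. For a user subset $S$, let $W_{n,S}$ be the set of bits of file $n$ stored exactly by the users in $S$. For $\mathbf a=(a_{n,l})_{1\le n\le N,\,0\le l\le K}$ and $\mathcal D\subseteq\{1,\dots,N\}$ put $$R_{\mathrm{lb}}(\mathcal D;\mathbf a)=\max_{\pi}\sum_{l=0}^{K-1}\sum_{i=1}^{|\mathcal D|}\binom{K-i}{l}a_{\pi(i),l},$$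 the maximum being over all bijections $\pi:\{1,\dots,|\mathcal D|\}\to\mathcal D$. Let $\mathcal T(\mathcal D)$ be the set of demand vectors whose set of distinct entries is $\mathcal D$. Consider the problem $$\textbf{P1}:\quad \min_{\mathbf a}\ \bar R_{\mathrm{lb}}(\mathbf a)=\sum_{\mathcal D\subseteq\{1,\dots,N\}}\ \sum_{\mathbf d\in\mathcal T(\mathcal D)}\Big(\prod_{i=1}^K p_{d_i}\Big)R_{\mathrm{lb}}(\mathcal D;\mathbf a)$$ subject to $\sum_{l=0}^K\binom Kl a_{n,l}=1$ for all $n$, $\ \sum_{n=1}^N\sum_{l=1}^K\binom{K-1}{l-1}a_{n,l}\le M$, and $a_{n,l}\ge 0$ for all $n,l$. **Lemma 1.** (i) The minimum in **P1** is attained, and for every $F\ge1$ it is a lower bound on the average delivery rate $\bar R$ of every caching scheme with uncoded placement. (ii) If the placement of such a scheme has $|W_{n,S}|=a_{n,|S|}F$ for all $n$ and $S$, then $\mathbf a$ satisfies the constraints of **P1**, and $R(\mathbf d)\ge R_{\mathrm{lb}}(\mathcal D;\mathbf a)$ for every demand vector $\mathbf d$, where $\mathcal D$ is the set of distinct entries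 of $\mathbf d$. -/

import Mathlib

open Finset

namespace CodedCaching

/-- The contents of the database: `N` files of `F` bits each. -/
abbrev Library (N F : ℕ) : Type := Fin N → Fin F → Bool

/-- A demand vector: user `k` requests the file `d k`. -/
abbrev Demand (K N : ℕ) : Type := Fin K → Fin N

/-- A caching scheme with uncoded placement for `K` users, `N` files of `F` bits, and caches of
`M * F` bits. The placement stores, at each user, verbatim copies of selected bits of the files.
The delivery phase is arbitrary: for each demand vector `d` the server multicasts a message of
`length d` bits that may be any function of the library, and each user recovers the file it
requested, without error, from this message and the contents of its own cache. -/
structure UncodedScheme (K N F : ℕ) (M : ℝ) where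
  /-- The positions (file, bit) of the bits stored at each user. -/
  cache : Fin K → Finset (Fin N × Fin F)
  cache_size : ∀ k, ((cache k).card : ℝ) ≤ M * F
  /-- The number of bits multicast for each demand vector. -/
  length : Demand K N → ℕ
  /-- The multicast message. -/
  encode : (d : Demand K N) → Library N F → (Fin (length d) → Bool)
  /-- The decoder of each user, applied to the message and to the user's cached bits. -/
  decode : (d : Demand K N) → (k : Fin K) → (Fin (length d) → Bool) →
    ({b : Fin N × Fin F // b ∈ cache k} → Bool) → (Fin F → Bool)
  correct : ∀ (d : Demand K N) (k : Fin K) (W : Library N F),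
    decode d k (encode d W) (fun b => W b.1.1 b.1.2) = W (d k)

namespace UncodedScheme

variable {K N F : ℕ} {M : ℝ}

/-- The delivery rate for the demand vector `d`: message length in units of the file size. -/
noncomputable def rate (s : UncodedScheme K N F M) (d : Demand K N) : ℝ :=
  (s.length d : ℝ) / F

/-- The average delivery rate when the users request files independently with distribution `p`. -/
noncomputable def avgRate (s : UncodedScheme K N F M) (p : Fin N → ℝ) : ℝ :=
  ∑ d : Demand K N, (∏ i, p (d i)) * s.rate d

/-- The subfile `W_{n,S}`: the bits of file `n` that are stored exactly at the users in `S`. -/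
def subfile (s : UncodedScheme K N F M) (n : Fin N) (S : Finset (Fin K)) : Finset (Fin F) :=
  {j | ∀ k, (n, j) ∈ s.cache k ↔ k ∈ S}

/-- The placement of the scheme is described by the vector `a`: every subfile `W_{n,S}` has
size `a_{n,|S|} F`, so that it depends on `S` through `|S|` only. -/
def HasPlacement (s : UncodedScheme K N F M) (a : Fin N → Fin (K + 1) → ℝ) : Prop :=
  ∀ (n : Fin N) (S : Finset (Fin K)),
    ((s.subfile n S).card : ℝ) = a n ⟨S.card, Nat.lt_succ_of_le (card_finset_fin_le S)⟩ * F

end UncodedScheme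

/-- The feasible set: the file-partition, cache-size and nonnegativity constraints on the
placement vector `a`. In the cache-size constraint, `l : Fin K` stands for the subset size
`l + 1`. -/
def feasible (K N : ℕ) (M : ℝ) : Set (Fin N → Fin (K + 1) → ℝ) :=
  {a | (∀ n, ∑ l : Fin (K + 1), (K.choose l : ℝ) * a n l = 1) ∧
    (∑ n, ∑ l : Fin K, ((K - 1).choose l : ℝ) * a n l.succ ≤ M) ∧
    (∀ n l, 0 ≤ a n l)}

/-- The set of demand vectors whose set of distinct entries is `D`. -/
def demandsOf (K : ℕ) {N : ℕ} (D : Finset (Fin N)) : Finset (Demand K N) :=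
  {d | univ.image d = D}

/-- `R_lb(D; a)`: the maximum, over all bijections `π` from `{1, …, |D|}` onto `D`, of
`∑_{l=0}^{K-1} ∑_{i=1}^{|D|} C(K - i, l) a_{π(i), l}`. -/
noncomputable def lbRate {K N : ℕ} (D : Finset (Fin N)) (a : Fin N → Fin (K + 1) → ℝ) : ℝ :=
  (univ : Finset (Fin D.card ≃ D)).sup' ⟨D.equivFin.symm, mem_univ _⟩ fun π =>
    ∑ l : Fin K, ∑ i : Fin D.card,
      ((K - ((i : ℕ) + 1)).choose l : ℝ) * a (π i : Fin N) l.castSucc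

/-- The objective: the expectation of `R_lb(D; a)` over the random demands. -/
noncomputable def avgLbRate {K N : ℕ} (p : Fin N → ℝ) (a : Fin N → Fin (K + 1) → ℝ) : ℝ :=
  ∑ D : Finset (Fin N), ∑ d ∈ demandsOf K D, (∏ i, p (d i)) * lbRate D a

end CodedCaching

namespace CodedCaching

/-! Fix users with distinct demands in some order. Served successively, with earlier files known,
they recover from the message alone every bit of the i-th file that none of the first i users
caches, once all other bits are fixed. The message is therefore at least as long as the number of
these bits (`sum_card_subfile_le_length`). If subfile sizes depend only on |S|, counting subsets of
the remaining K - i users gives `lbRate`. For an arbitrary placement, this bound is averaged over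
all relabelings of the users. Subfile sizes become averages over sets of equal size, which form a
feasible vector, while the average rate is unchanged because demands are i.i.d. The minimum is
attained by compactness. -/

/-! ### Averaging set functions over user permutations -/

/-- The average of a set function over the subsets of size `l`. -/
noncomputable def cardAvg {K : ℕ} (w : Finset (Fin K) → ℝ) (l : ℕ) : ℝ :=
  (∑ S ∈ powersetCard l univ, w S) / (K.choose l : ℝ)

theorem choose_mul_cardAvg {K : ℕ} (w : Finset (Fin K) → ℝ) {l : ℕ} (hl : l ≤ K) :
    (K.choose l : ℝ) * cardAvg w l = ∑ S ∈ powersetCard l univ, w S := by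
  have : (K.choose l : ℝ) ≠ 0 := by exact_mod_cast (Nat.choose_pos hl).ne'
  unfold cardAvg
  field_simp

theorem cardAvg_of_forall {K : ℕ} {w : Finset (Fin K) → ℝ} {l : ℕ} (hl : l ≤ K) {c : ℝ}
    (h : ∀ S : Finset (Fin K), S.card = l → w S = c) : cardAvg w l = c := by
  have hne : (K.choose l : ℝ) ≠ 0 := by exact_mod_cast (Nat.choose_pos hl).ne'
  unfold cardAvg
  rw [sum_congr rfl fun S hS => h S (mem_powersetCard.1 hS).2, sum_const, card_powersetCard,
    card_univ, Fintype.card_fin, nsmul_eq_mul]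
  field_simp

theorem exists_perm_map_eq {K : ℕ} {S T : Finset (Fin K)} (h : S.card = T.card) :
    ∃ τ : Equiv.Perm (Fin K), S.map τ.toEmbedding = T := by
  refine ⟨(Finset.equivOfCardEq h).extendSubtype, eq_of_subset_of_card_le ?_ (by simp [h])⟩
  intro x hx
  obtain ⟨y, hy, rfl⟩ := mem_map.1 hx
  exact (Finset.equivOfCardEq h).extendSubtype_mem y hy

/-- Permutations act transitively on sets of a given size, so the sum is the same for every set of
size `T.card`; summing over those sets and exchanging the sums gives its value. -/
theorem sum_perm_map {K : ℕ} (w : Finset (Fin K) → ℝ) (T : Finset (Fin K)) :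
    ∑ σ : Equiv.Perm (Fin K), w (T.map σ.toEmbedding) = (K.factorial : ℝ) * cardAvg w T.card := by
  have hinv (S : Finset (Fin K)) (hS : S ∈ powersetCard T.card univ) :
      ∑ σ : Equiv.Perm (Fin K), w (S.map σ.toEmbedding) =
        ∑ σ : Equiv.Perm (Fin K), w (T.map σ.toEmbedding) := by
    obtain ⟨τ, rfl⟩ := exists_perm_map_eq (mem_powersetCard.1 hS).2.symm
    refine Fintype.sum_equiv (Equiv.mulRight τ) _ _ fun σ => ?_
    rw [map_map]
    rfl
  have hT : T.card ≤ K := card_finset_fin_le T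
  have key : ∑ S ∈ powersetCard T.card univ, ∑ σ : Equiv.Perm (Fin K), w (S.map σ.toEmbedding) =
      (K.factorial : ℝ) * ∑ S ∈ powersetCard T.card univ, w S := by
    rw [sum_comm]
    have (σ : Equiv.Perm (Fin K)) : ∑ S ∈ powersetCard T.card univ, w (S.map σ.toEmbedding) =
        ∑ S ∈ powersetCard T.card univ, w S := by
      refine sum_equiv σ.finsetCongr (fun S => ?_) fun S _ => rfl
      simp [mem_powersetCard]
    rw [sum_congr rfl fun σ _ => this σ, sum_const, card_univ, Fintype.card_perm, Fintype.card_fin,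
      nsmul_eq_mul]
  rw [sum_congr rfl hinv, sum_const, card_powersetCard, card_univ, Fintype.card_fin, nsmul_eq_mul,
    ← choose_mul_cardAvg w hT] at key
  have hne : (K.choose T.card : ℝ) ≠ 0 := by exact_mod_cast (Nat.choose_pos hT).ne'
  exact mul_left_cancel₀ hne (by rw [key]; ring)

theorem sum_powerset_card_eq {K : ℕ} (g : ℕ → ℝ) {U : Finset (Fin K)} (hU : U.card < K) :
    ∑ T ∈ U.powerset, g T.card = ∑ l : Fin K, (U.card.choose l : ℝ) * g l := by
  rw [sum_powerset_apply_card, Fin.sum_univ_eq_sum_range fun l => (U.card.choose l : ℝ) * g l]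
  simp only [nsmul_eq_mul]
  -- As `U.card < K`, the sizes up to `U.card` all lie below `K`; the extra terms have zero
  -- binomials.
  refine sum_subset (fun l hl => ?_) fun l _ hl => ?_
  · simp only [mem_range] at *
    omega
  · rw [Nat.choose_eq_zero_of_lt (by simpa using hl)]
    simp

/-! ### Counting cached bits and the cut-set bound -/

namespace UncodedScheme

variable {K N F : ℕ} {M : ℝ}

/-- The set of users that store bit `j` of file `n`. -/
def users (s : UncodedScheme K N F M) (n : Fin N) (j : Fin F) : Finset (Fin K) :=
  {k | (n, j) ∈ s.cache k}

theorem mem_users (s : UncodedScheme K N F M) {n : Fin N} {j : Fin F} {k : Fin K} :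
    k ∈ s.users n j ↔ (n, j) ∈ s.cache k := by
  simp [users]

theorem subfile_eq (s : UncodedScheme K N F M) (n : Fin N) (S : Finset (Fin K)) :
    s.subfile n S = ({j | s.users n j = S} : Finset (Fin F)) := by
  ext j
  simp [subfile, users, Finset.ext_iff]

theorem sum_card_subfile (s : UncodedScheme K N F M) (n : Fin N) (A : Finset (Finset (Fin K))) :
    ∑ S ∈ A, (s.subfile n S).card = ({j | s.users n j ∈ A} : Finset (Fin F)).card := by
  simp only [subfile_eq]
  exact sum_card_fiberwise_eq_card_filter _ _ _

theorem sum_card_subfile_univ (s : UncodedScheme K N F M) (n : Fin N) :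
    ∑ S, (s.subfile n S).card = F := by
  rw [sum_card_subfile]
  simp

theorem sum_card_mul_card_subfile (s : UncodedScheme K N F M) :
    ∑ n, ∑ S, S.card * (s.subfile n S).card = ∑ k, (s.cache k).card := by
  have h1 (n : Fin N) : ∑ S, S.card * (s.subfile n S).card = ∑ j, (s.users n j).card := by
    rw [← sum_fiberwise univ (s.users n)]
    refine sum_congr rfl fun S _ => ?_
    rw [subfile_eq, sum_congr rfl fun j hj => congrArg card (mem_filter.1 hj).2, sum_const,
      smul_eq_mul, mul_comm]
  simp only [h1]
  rw [← Fintype.sum_prod_type' fun n j => (s.users n j).card]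
  simp only [users, card_filter]
  rw [sum_comm]
  simp

/-- The cut-set bound along a sequence of users with distinct demands. -/
theorem sum_card_subfile_le_length (s : UncodedScheme K N F M) (d : Demand K N) {m : ℕ}
    (u : Fin m → Fin K) (hu : Function.Injective (d ∘ u)) :
    ∑ i, ∑ S ∈ ((Iic i).image u)ᶜ.powerset, (s.subfile (d (u i)) S).card ≤ s.length d := by
  simp only [sum_card_subfile]
  set B : Fin m → Finset (Fin F) :=
    fun i => {j | s.users (d (u i)) j ∈ ((Iic i).image u)ᶜ.powerset} with hB
  let e : (Σ _ : Fin m, Fin F) ↪ Fin N × Fin F :=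
    ⟨fun x => (d (u x.1), x.2), by
      rintro ⟨i, j⟩ ⟨i', j'⟩ h
      simp only [Prod.mk.injEq] at h
      obtain ⟨h1, rfl⟩ := h
      obtain rfl : i = i' := hu h1
      rfl⟩
  set P : Finset (Fin N × Fin F) := (univ.sigma B).map e with hP
  have hcard : P.card = ∑ i, (B i).card := by rw [hP, card_map, card_sigma]
  rw [← hcard]
  -- Bits outside `P` are frozen to `false`, so a library is determined by its bits on `P`;
  -- injectivity of encoding then gives 2^|P| ≤ 2^length.
  let lib : (P → Bool) → Library N F := fun f n j => if h : (n, j) ∈ P then f ⟨(n, j), h⟩ else false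
  have hinj : Function.Injective fun f => s.encode d (lib f) := by
    intro f g hfg
    have key : ∀ i, lib f (d (u i)) = lib g (d (u i)) := by
      intro i
      induction i using WellFoundedLT.induction with
      | _ i ih =>
        rw [← s.correct d (u i) (lib f), ← s.correct d (u i) (lib g)]
        congr 1
        funext ⟨⟨n, j⟩, hb⟩
        by_cases h : (n, j) ∈ P
        · obtain ⟨⟨i', j'⟩, hx, hxe⟩ := mem_map.1 h
          obtain ⟨rfl, rfl⟩ := Prod.mk.inj hxe
          -- A bit of `P` in file `d (u i')` is cached by none of the users `u 0, …, u i'`. If `u i`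
          -- caches it, then i' < i and induction applies.
          have hlt : i' < i := by
            by_contra! hle
            have hmem := (mem_sigma.1 hx).2
            simp only [hB, mem_filter, mem_univ, true_and, mem_powerset] at hmem
            have := hmem (s.mem_users.2 hb)
            exact (mem_compl.1 this) (mem_image_of_mem u (mem_Iic.2 hle))
          exact congrFun (ih i' hlt) j'
        · simp [lib, h]
    funext ⟨⟨n, j⟩, hb⟩
    obtain ⟨⟨i, j'⟩, hx, hxe⟩ := mem_map.1 hb
    obtain ⟨rfl, rfl⟩ := Prod.mk.inj hxe
    have := congrFun (key i) j'
    simpa only [lib, dif_pos hb] using this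
  have := Fintype.card_le_of_injective _ hinj
  simp only [Fintype.card_fun, Fintype.card_bool, Fintype.card_coe, Fintype.card_fin] at this
  exact (Nat.pow_le_pow_iff_right (by norm_num)).1 this

/-- The normalized size of a subfile. -/
noncomputable def share (s : UncodedScheme K N F M) (n : Fin N) (S : Finset (Fin K)) : ℝ :=
  ((s.subfile n S).card : ℝ) / F

/-- The placement vector obtained by averaging the subfile sizes over the user subsets of each
size. -/
noncomputable def avgPlacement (s : UncodedScheme K N F M) (n : Fin N) (l : Fin (K + 1)) : ℝ :=
  cardAvg (s.share n) l

theorem HasPlacement.avgPlacement_eq {s : UncodedScheme K N F M} (hF : 0 < F)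
    {a : Fin N → Fin (K + 1) → ℝ} (h : s.HasPlacement a) : s.avgPlacement = a := by
  funext n l
  refine cardAvg_of_forall (Nat.lt_succ_iff.1 l.2) fun S hS => ?_
  have hF' : (F : ℝ) ≠ 0 := by exact_mod_cast hF.ne'
  rw [share, h n S, mul_div_cancel_right₀ _ hF']
  congr 1
  exact Fin.ext hS

theorem avgPlacement_mem_feasible (s : UncodedScheme K N F M) (hF : 0 < F) (hM : 0 ≤ M) :
    s.avgPlacement ∈ feasible K N M := by
  have hF' : (0 : ℝ) < F := by exact_mod_cast hF
  refine ⟨fun n => ?_, ?_, fun n l => ?_⟩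
  · have h1 : ∑ l : Fin (K + 1), (K.choose l : ℝ) * s.avgPlacement n l = ∑ S, s.share n S := by
      have hl (l : Fin (K + 1)) := choose_mul_cardAvg (s.share n) (Nat.lt_succ_iff.1 l.2)
      simp only [avgPlacement, hl]
      rw [Fin.sum_univ_eq_sum_range fun l => ∑ S ∈ powersetCard l univ, s.share n S,
        ← powerset_univ, sum_powerset]
      simp
    rw [h1]
    simp only [share]
    rw [← sum_div, ← Nat.cast_sum, sum_card_subfile_univ, div_self hF'.ne']
  · obtain rfl | hK := Nat.eq_zero_or_pos K
    · simpa using hM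
    have hK' : (0 : ℝ) < K := by exact_mod_cast hK
    -- Multiplying by K turns the constraint into a count of all cached bits, via K·C(K-1, l) =
    -- (l+1)·C(K, l+1).
    have h1 (n : Fin N) : (K : ℝ) * ∑ l : Fin K, ((K - 1).choose l : ℝ) * s.avgPlacement n l.succ =
        ∑ S : Finset (Fin K), (S.card : ℝ) * s.share n S := by
      have hl (l : Fin K) : (K : ℝ) * (((K - 1).choose l : ℝ) * s.avgPlacement n l.succ) =
          ∑ S ∈ powersetCard (l + 1) univ, (S.card : ℝ) * s.share n S := by
        have hc : (K : ℝ) * ((K - 1).choose l : ℝ) = (K.choose (l + 1) : ℝ) * ((l + 1 : ℕ) : ℝ) := by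
          have := Nat.add_one_mul_choose_eq (K - 1) l
          rw [Nat.sub_add_cancel hK] at this
          exact_mod_cast this
        have h2 := choose_mul_cardAvg (s.share n) (l := l + 1) (by omega)
        calc _ = ((l + 1 : ℕ) : ℝ) * ((K.choose (l + 1) : ℝ) * cardAvg (s.share n) (l + 1)) := by
              rw [← mul_assoc, hc, avgPlacement, Fin.val_succ]
              ring
          _ = _ := by
              rw [h2, mul_sum]
              exact sum_congr rfl fun S hS => by rw [(mem_powersetCard.1 hS).2]
      rw [mul_sum, sum_congr rfl fun l _ => hl l,
        Fin.sum_univ_eq_sum_range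
          fun l => ∑ S ∈ powersetCard (l + 1) univ, (S.card : ℝ) * s.share n S,
        ← powerset_univ, sum_powerset, card_univ, Fintype.card_fin, sum_range_succ']
      simp
    have h2 : (K : ℝ) * ∑ n, ∑ l : Fin K, ((K - 1).choose l : ℝ) * s.avgPlacement n l.succ =
        ((∑ k, (s.cache k).card : ℕ) : ℝ) / F := by
      rw [mul_sum, sum_congr rfl fun n _ => h1 n, ← sum_card_mul_card_subfile]
      push_cast
      simp only [share, sum_div, mul_div_assoc]
    have h3 : ((∑ k, (s.cache k).card : ℕ) : ℝ) ≤ K * (M * F) := by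
      push_cast
      refine (sum_le_sum fun k _ => s.cache_size k).trans ?_
      simp
    refine le_of_mul_le_mul_left ?_ hK'
    rw [h2, div_le_iff₀ hF', mul_assoc]
    exact h3
  · unfold avgPlacement cardAvg share
    positivity

theorem sum_share_le_rate (s : UncodedScheme K N F M) (d : Demand K N) {m : ℕ}
    (u : Fin m → Fin K) (hu : Function.Injective (d ∘ u)) :
    ∑ i, ∑ S ∈ ((Iic i).image u)ᶜ.powerset, s.share (d (u i)) S ≤ s.rate d := by
  simp only [share, rate, ← sum_div]
  refine div_le_div_of_nonneg_right ?_ (Nat.cast_nonneg F)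
  exact_mod_cast s.sum_card_subfile_le_length d u hu

theorem card_compl_image_Iic {m : ℕ} {u : Fin m → Fin K} (hu : Function.Injective u) (i : Fin m) :
    ((Iic i).image u)ᶜ.card = K - ((i : ℕ) + 1) := by
  rw [card_compl, card_image_of_injective _ hu, Fin.card_Iic, Fintype.card_fin]

theorem sum_powerset_eq {m : ℕ} (u : Fin m → Fin K) (hu : Function.Injective u)
    (i : Fin m) (g : ℕ → ℝ) :
    ∑ T ∈ ((Iic i).image u)ᶜ.powerset, g T.card =
      ∑ l : Fin K, ((K - ((i : ℕ) + 1)).choose l : ℝ) * g l := by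
  have hK : 0 < K := (Nat.zero_le _).trans_lt (u i).2
  have hc := card_compl_image_Iic hu i
  rw [sum_powerset_card_eq g (by omega), hc]

theorem exists_users_of_equiv (d : Demand K N) (π : Fin (univ.image d).card ≃ univ.image d) :
    ∃ u : Fin (univ.image d).card → Fin K, ∀ i, d (u i) = π i := by
  have h (i) : ∃ k, d k = π i := by
    obtain ⟨k, -, hk⟩ := mem_image.1 (π i).2
    exact ⟨k, hk⟩
  exact ⟨fun i => (h i).choose, fun i => (h i).choose_spec⟩

/-! ### From the cut-set bound to the average rate -/

theorem lbRate_le_of_hasPlacement {s : UncodedScheme K N F M} (hF : 0 < F)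
    {a : Fin N → Fin (K + 1) → ℝ} (h : s.HasPlacement a) (d : Demand K N) :
    lbRate (univ.image d) a ≤ s.rate d := by
  refine sup'_le _ _ fun π _ => ?_
  obtain ⟨u, hu⟩ := exists_users_of_equiv d π
  have hdu : Function.Injective (d ∘ u) := fun i j hij =>
    π.injective (Subtype.ext (by rw [← hu i, ← hu j]; exact hij))
  have hF' : (F : ℝ) ≠ 0 := by exact_mod_cast hF.ne'
  refine le_trans (le_of_eq ?_) (s.sum_share_le_rate d u hdu)
  rw [sum_comm]
  refine sum_congr rfl fun i _ => ?_
  rw [← h.avgPlacement_eq hF, ← hu i]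
  refine (sum_powerset_eq u hdu.of_comp i (cardAvg (s.share (d (u i))))).symm.trans ?_
  refine sum_congr rfl fun S _ => ?_
  refine cardAvg_of_forall (card_finset_fin_le S) fun T hT => ?_
  rw [share, share, h, h]
  simp only [hT]

/-- For demand `d ∘ σ`, the users `σ⁻¹ ∘ u` request the same files in the same order; summing their
cut-set bounds over σ replaces each share by its average over sets of equal size. -/
theorem lbRate_avgPlacement_le (s : UncodedScheme K N F M) (d : Demand K N) :
    (K.factorial : ℝ) * lbRate (univ.image d) s.avgPlacement ≤
      ∑ σ : Equiv.Perm (Fin K), s.rate (d ∘ σ) := by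
  have hfac : (0 : ℝ) < K.factorial := by exact_mod_cast K.factorial_pos
  rw [← le_div_iff₀' hfac]
  refine sup'_le _ _ fun π _ => ?_
  rw [le_div_iff₀' hfac]
  obtain ⟨u, hu⟩ := exists_users_of_equiv d π
  have hdu : Function.Injective (d ∘ u) := fun i j hij =>
    π.injective (Subtype.ext (by rw [← hu i, ← hu j]; exact hij))
  have hσ (σ : Equiv.Perm (Fin K)) :
      ∑ i, ∑ T ∈ ((Iic i).image u)ᶜ.powerset, s.share (d (u i)) (T.map σ.symm.toEmbedding) ≤
        s.rate (d ∘ σ) := by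
    have h := s.sum_share_le_rate (d ∘ σ) (σ.symm ∘ u)
      (by simpa [Function.comp_def] using hdu)
    refine le_trans (le_of_eq ?_) h
    refine sum_congr rfl fun i _ => ?_
    refine sum_equiv σ.symm.finsetCongr (fun T => ?_) fun T _ => by simp
    simp only [mem_powerset, Equiv.finsetCongr_apply, subset_iff, mem_map_equiv, mem_compl,
      mem_image, mem_Iic, Function.comp_apply, Equiv.symm_symm]
    rw [σ.symm.forall_congr_left]
    simp [Equiv.symm_apply_eq]
  refine le_trans (le_of_eq ?_) (sum_le_sum fun σ _ => hσ σ)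
  rw [sum_comm, mul_sum, sum_comm]
  refine sum_congr rfl fun i _ => ?_
  rw [sum_comm, ← hu i]
  have hT (T : Finset (Fin K)) :
      ∑ σ : Equiv.Perm (Fin K), s.share (d (u i)) (T.map σ.symm.toEmbedding) =
        (K.factorial : ℝ) * cardAvg (s.share (d (u i))) T.card := by
    rw [← sum_perm_map]
    exact Fintype.sum_equiv (Equiv.inv _) _ _ fun σ => rfl
  rw [sum_congr rfl fun T _ => hT T, ← mul_sum, sum_powerset_eq u hdu.of_comp i]
  rfl

end UncodedScheme

theorem avgLbRate_eq {K N : ℕ} (p : Fin N → ℝ) (a : Fin N → Fin (K + 1) → ℝ) :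
    avgLbRate p a = ∑ d : Demand K N, (∏ i, p (d i)) * lbRate (univ.image d) a := by
  rw [← sum_fiberwise univ (fun d : Demand K N => univ.image d)]
  refine sum_congr rfl fun D _ => sum_congr rfl fun d hd => ?_
  rw [(mem_filter.1 hd).2]

theorem UncodedScheme.avgLbRate_avgPlacement_le {K N F : ℕ} {M : ℝ} (s : UncodedScheme K N F M)
    {p : Fin N → ℝ} (hp : ∀ n, 0 ≤ p n) : avgLbRate p s.avgPlacement ≤ s.avgRate p := by
  have hfac : (0 : ℝ) < K.factorial := by exact_mod_cast K.factorial_pos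
  refine le_of_mul_le_mul_left ?_ hfac
  rw [avgLbRate_eq, mul_sum]
  calc _ ≤ ∑ d : Demand K N, ∑ σ : Equiv.Perm (Fin K), (∏ i, p (d i)) * s.rate (d ∘ σ) := by
        refine sum_le_sum fun d _ => ?_
        rw [mul_left_comm, ← mul_sum]
        exact mul_le_mul_of_nonneg_left (s.lbRate_avgPlacement_le d)
          (prod_nonneg fun i _ => hp _)
    _ = ∑ _σ : Equiv.Perm (Fin K), s.avgRate p := by
        rw [sum_comm]
        refine sum_congr rfl fun σ _ => ?_
        -- The weight of a demand is invariant under permuting users, so d ↦ d ∘ σ preserves the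
        -- average.
        refine Fintype.sum_equiv (σ.symm.arrowCongr (Equiv.refl _)) _ _ fun d => ?_
        have : σ.symm.arrowCongr (Equiv.refl _) d = d ∘ σ := rfl
        rw [this]
        congr 1
        exact (Equiv.prod_comp σ fun i => p (d i)).symm
    _ = _ := by simp [Fintype.card_perm]

/-! ### Attainment of the minimum -/

theorem continuous_lbRate {K N : ℕ} (D : Finset (Fin N)) :
    Continuous fun a : Fin N → Fin (K + 1) → ℝ => lbRate D a := by
  unfold lbRate
  refine Continuous.finset_sup'_apply _ fun π _ => ?_
  fun_prop

theorem continuous_avgLbRate {K N : ℕ} (p : Fin N → ℝ) :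
    Continuous fun a : Fin N → Fin (K + 1) → ℝ => avgLbRate p a := by
  unfold avgLbRate
  exact continuous_finsetSum _ fun D _ => continuous_finsetSum _ fun d _ =>
    continuous_const.mul (continuous_lbRate D)

theorem isCompact_feasible (K N : ℕ) (M : ℝ) : IsCompact (feasible K N M) := by
  -- The unit box suffices: each term of the partition constraint is nonnegative with coefficient
  -- C(K, l) ≥ 1.
  refine (isCompact_Icc (a := (0 : Fin N → Fin (K + 1) → ℝ)) (b := 1)).of_isClosed_subset ?_ ?_
  · have h1 : IsClosed {a : Fin N → Fin (K + 1) → ℝ |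
        ∀ n, ∑ l : Fin (K + 1), (K.choose l : ℝ) * a n l = 1} := by
      simp only [Set.ofPred_forall]
      exact isClosed_iInter fun n => isClosed_eq (by fun_prop) continuous_const
    have h2 : IsClosed {a : Fin N → Fin (K + 1) → ℝ |
        ∑ n, ∑ l : Fin K, ((K - 1).choose l : ℝ) * a n l.succ ≤ M} :=
      isClosed_le (by fun_prop) continuous_const
    have h3 : IsClosed {a : Fin N → Fin (K + 1) → ℝ | ∀ n l, 0 ≤ a n l} := by
      simp only [Set.ofPred_forall]
      exact isClosed_iInter fun n => isClosed_iInter fun l =>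
        isClosed_le continuous_const (by fun_prop)
    exact h1.inter (h2.inter h3)
  · rintro a ⟨h1, -, h0⟩
    refine ⟨fun n l => h0 n l, fun n l => ?_⟩
    have hc : (1 : ℝ) ≤ K.choose l := by
      exact_mod_cast Nat.choose_pos (Nat.lt_succ_iff.1 l.2)
    calc a n l ≤ (K.choose l : ℝ) * a n l := le_mul_of_one_le_left (h0 n l) hc
      _ ≤ ∑ l : Fin (K + 1), (K.choose l : ℝ) * a n l :=
        single_le_sum (f := fun l : Fin (K + 1) => (K.choose l : ℝ) * a n l)
          (fun l _ => mul_nonneg (Nat.cast_nonneg _) (h0 n l)) (mem_univ l)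
      _ = 1 := h1 n

theorem feasible_nonempty (K N : ℕ) {M : ℝ} (hM : 0 ≤ M) : (feasible K N M).Nonempty := by
  -- Nothing is cached: each file lies entirely in its l = 0 subfile.
  refine ⟨fun _ l => if l = 0 then 1 else 0, fun n => by simp, by simpa using hM, fun n l => ?_⟩
  dsimp only
  split_ifs <;> norm_num

end CodedCaching

theorem lemma1 (K N : ℕ) (p : Fin N → ℝ) (hp : ∀ n, 0 ≤ p n) (hp1 : ∑ n, p n = 1)
    (M : ℝ) (hM : 0 ≤ M) :
    (∃ v : ℝ,
      IsLeast (CodedCaching.avgLbRate p '' CodedCaching.feasible K N M) v ∧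
      ∀ (F : ℕ), 0 < F → ∀ s : CodedCaching.UncodedScheme K N F M, v ≤ s.avgRate p) ∧
    (∀ (F : ℕ), 0 < F → ∀ (s : CodedCaching.UncodedScheme K N F M)
      (a : Fin N → Fin (K + 1) → ℝ), s.HasPlacement a →
        a ∈ CodedCaching.feasible K N M ∧
        ∀ d : CodedCaching.Demand K N,
          CodedCaching.lbRate (Finset.univ.image d) a ≤ s.rate d) := by
  refine ⟨?_, fun F hF s a ha => ⟨?_, fun d =>
    CodedCaching.UncodedScheme.lbRate_le_of_hasPlacement hF ha d⟩⟩
  · obtain ⟨a, ha, hmin⟩ := (CodedCaching.isCompact_feasible K N M).exists_isMinOn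
      (CodedCaching.feasible_nonempty K N hM) (CodedCaching.continuous_avgLbRate p).continuousOn
    refine ⟨CodedCaching.avgLbRate p a, ⟨⟨a, ha, rfl⟩, ?_⟩, fun F hF s => ?_⟩
    · rintro _ ⟨b, hb, rfl⟩
      exact hmin hb
    · exact le_trans (hmin (s.avgPlacement_mem_feasible hF hM)) (s.avgLbRate_avgPlacement_le hp)
  · rw [← ha.avgPlacement_eq hF]
    exact s.avgPlacement_mem_feasible hF hM
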